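/- Let $I=[-1,1]$. For $k\in\mathbb N=\{1,2,\dots\}$, a bounded function $g:I\to\mathbb R$ and $t>0$, let $$\omega_k(g,t)=\sup_{0<u\le t}\ \sup_{x\in I}|\Delta_u^k(g,x)|$$ be the $k$th modulus of smoothness of $g$ on $I$, where $\Delta^k_u(g,x)=\sum_{i=0}^k(-1)^i\binom ki g\bigl(x+(\tfrac k2-i)u\bigr)$ if $x-\tfrac{ku}2\in I$ and $x+\tfrac{ku}2\in I$, and $\Delta^k_u(g,x)=0$ otherwise. Let $C^r(I)$ be the space of real-valued $r$ times continuously differentiable functions on $I$ (with one-sided derivatives at the endpoints). Let $k\in\mathbb N$, let $r\ge 0$ be an integer, let $x_0\in I$, and let $\varepsilon:(0,1]\to(0,\infty)$ be a continuous function with $\lim_{x\to0^+}\varepsilon(x)=0$. Then there is a function $F\in C^r(I)$ such that, for every algebraic polynomial $P$ (with real coefficients, of any degree) and all real numbers $\alpha\ge 0$ and $\beta$ with $\alpha+k\beta=r+1$, $$\limsup_{x\to x_0,\ x\in I\setminus\{x_0\}}\frac{|F(x)-P(x)|}{|x-x_0|^{\alpha}\,\omega_k\bigl(F^{(r)},\,\varepsilon(|x-x_0|)\,|x-x_0|^{\beta}\bigr)}=\infty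 .$$ In particular, the same $F$ works for all $P$, $\alpha$ and $\beta$. -/

import Mathlib

open Set Filter Topology

noncomputable section

open Classical in
/-- The `k`th symmetric difference of `f` at `x` with step `u`, relative to `J`:
`∑ (-1)^i (k choose i) f (x + (k/2 - i) u)` if both `x - k u / 2` and `x + k u / 2` lie in `J`,
and `0` otherwise. -/
def symmDifference (k : ℕ) (u : ℝ) (f : ℝ → ℝ) (x : ℝ) (J : Set ℝ) : ℝ :=
  if x - (k : ℝ) * u / 2 ∈ J ∧ x + (k : ℝ) * u / 2 ∈ J then
    ∑ i ∈ Finset.range (k + 1),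
      (-1 : ℝ) ^ i * (Nat.choose k i : ℝ) * f (x + ((k : ℝ) / 2 - (i : ℝ)) * u)
  else 0

/-- The `k`th modulus of smoothness of a function `f` that is bounded on the interval `J`:
the supremum of `|symmDifference k u f x J|` over all steps `0 < u ≤ t` and all points `x ∈ J`. -/
def smoothnessModulus (k : ℕ) (f : ℝ → ℝ) (t : ℝ) (J : Set ℝ) : ℝ :=
  sSup {y : ℝ | ∃ u ∈ Ioc (0 : ℝ) t, ∃ x ∈ J, y = |symmDifference k u f x J|}

end

/-!
The function is `F x = Φ (x - x₀)`, where `Φ` is the `r`-fold primitive (from `0`) of a lacunary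
sine series `g s = c sin s + ∑ sin (N_j s) / N_j` with frequencies growing as fast as needed.

Below the scale `1 / N_n` each of the first `n + 1` terms is comparable to `s`, so `Φ s` is
comparable to `n s ^ (r + 1)` there: `Φ s / s ^ (r + 1)` is unbounded, but grows as slowly as the
frequencies dictate. A polynomial is either `O(s ^ (r + 1))` at `x₀` or at least of order `s ^ r`;
in both cases `|F - P| / s ^ (r + 1)` is unbounded along a sequence of scales `y_n`
(`eventually_mul_pow_le_abs_sub_eval`).

For the denominator, the `k`th differences of the first `n + 1` terms with step `u` are at most
`(n + 2) (N_n u) ^ k`, and those of the remaining terms at most `2 ^ (k + 1) / N_{n+1}`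
(`abs_symmDifference_lacunarySine_le`). With `u ≤ ε(y) y ^ β` the first bound, multiplied by
`y ^ α`, is `(n + 2) (N_n ε(y)) ^ k y ^ (r + 1)`, because `α + k β = r + 1`. So if `y_n` is chosen
small in terms of `N_n`, and then `N_{n+1}` large in terms of `y_n`
(`exists_frequencies_and_scales`), the denominator at `x₀ ± y_n` is at most `2 y_n ^ (r + 1)`,
for all `α` and `β` simultaneously.

A quotient with a vanishing denominator has the value `0` in Lean, so the modulus of `g` has to be
positive. This is what the term `c sin s` is for: `c = 0` serves unless the modulus of the bare
series vanishes at some `t > 0`, and then `c = 1` does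
(`exists_smoothnessModulus_lacunarySine_pos`).
-/

/-! ### Iterated primitives -/

/-- The `m`-fold primitive of `g` based at `0`: each integration is from `0`. -/
noncomputable def iterPrimitive (g : ℝ → ℝ) : ℕ → ℝ → ℝ
  | 0 => g
  | m + 1 => fun x => ∫ s in (0 : ℝ)..x, iterPrimitive g m s

lemma iterPrimitive_continuous {g : ℝ → ℝ} (hg : Continuous g) (m : ℕ) :
    Continuous (iterPrimitive g m) := by
  induction m with
  | zero => exact hg
  | succ m ih => exact intervalIntegral.continuous_primitive (fun a b => ih.intervalIntegrable a b) 0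

lemma deriv_iterPrimitive_succ {g : ℝ → ℝ} (hg : Continuous g) (m : ℕ) :
    deriv (iterPrimitive g (m + 1)) = iterPrimitive g m := by
  funext x
  exact (iterPrimitive_continuous hg m).deriv_integral _ 0 x

lemma contDiff_iterPrimitive {g : ℝ → ℝ} (hg : Continuous g) (m : ℕ) :
    ContDiff ℝ m (iterPrimitive g m) := by
  induction m with
  | zero => exact contDiff_zero.2 hg
  | succ m ih =>
    push_cast
    rw [contDiff_succ_iff_deriv]
    refine ⟨fun x => ?_, by simp, by rwa [deriv_iterPrimitive_succ hg m]⟩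
    exact ((iterPrimitive_continuous hg m).integral_hasStrictDerivAt 0 x).hasDerivAt.differentiableAt

lemma iteratedDeriv_iterPrimitive {g : ℝ → ℝ} (hg : Continuous g) (m : ℕ) :
    iteratedDeriv m (iterPrimitive g m) = g := by
  induction m with
  | zero => exact iteratedDeriv_zero
  | succ m ih => rw [iteratedDeriv_succ', deriv_iterPrimitive_succ hg m, ih]

lemma iterPrimitive_neg (g : ℝ → ℝ) (m : ℕ) (x : ℝ) :
    iterPrimitive (fun s => -g s) m x = -iterPrimitive g m x := by
  induction m generalizing x with
  | zero => rfl
  | succ m ih => simp only [iterPrimitive, ih, intervalIntegral.integral_neg]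

lemma iterPrimitive_apply_neg {g : ℝ → ℝ} (hg : ∀ s, g (-s) = -g s) (m : ℕ) (x : ℝ) :
    iterPrimitive g m (-x) = (-1) ^ (m + 1) * iterPrimitive g m x := by
  induction m generalizing x with
  | zero => simp [iterPrimitive, hg]
  | succ m ih =>
    have h := intervalIntegral.integral_comp_neg (a := 0) (b := x) (iterPrimitive g m)
    simp only [ih, neg_zero, intervalIntegral.integral_const_mul] at h
    simp only [iterPrimitive]
    rw [intervalIntegral.integral_symm, ← h, pow_succ]
    ring

/-- Integrating an affine upper bound `m` times, on an interval to the right of the base point. -/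
lemma iterPrimitive_le {g : ℝ → ℝ} (hg : Continuous g) {a b y : ℝ}
    (h : ∀ s ∈ Icc 0 y, g s ≤ a * s + b) (m : ℕ) :
    ∀ s ∈ Icc 0 y, iterPrimitive g m s
      ≤ a * (s ^ (m + 1) / (m + 1).factorial) + b * (s ^ m / m.factorial) := by
  induction m with
  | zero => intro s hs; simpa [iterPrimitive] using h s hs
  | succ m ih =>
    intro s hs
    have h1 : ∫ t in (0 : ℝ)..s, iterPrimitive g m t ≤
        ∫ t in (0 : ℝ)..s, (a * (t ^ (m + 1) / (m + 1).factorial) + b * (t ^ m / m.factorial)) := by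
      refine intervalIntegral.integral_mono_on hs.1
        ((iterPrimitive_continuous hg m).intervalIntegrable _ _)
        (Continuous.intervalIntegrable (by fun_prop) _ _) fun t ht => ih t ⟨ht.1, ht.2.trans hs.2⟩
    refine h1.trans (le_of_eq ?_)
    rw [intervalIntegral.integral_add (Continuous.intervalIntegrable (by fun_prop) _ _)
      (Continuous.intervalIntegrable (by fun_prop) _ _)]
    simp only [intervalIntegral.integral_const_mul, intervalIntegral.integral_div, integral_pow]
    have e1 : ((m + 1 + 1).factorial : ℝ) = (m + 1 + 1) * (m + 1).factorial := by
      rw [Nat.factorial_succ]; push_cast; ring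
    have e2 : ((m + 1).factorial : ℝ) = (m + 1) * m.factorial := by
      rw [Nat.factorial_succ]; push_cast; ring
    have := Nat.factorial_pos m
    rw [e1, e2]
    push_cast
    field_simp
    ring

/-- Two-sided bounds for the iterated primitive of an odd function; by parity, bounds on the
positive side suffice. -/
lemma abs_iterPrimitive_bounds {g : ℝ → ℝ} (hg : Continuous g) (hodd : ∀ s, g (-s) = -g s)
    {a a' b y s : ℝ} (ha : 0 ≤ a) (ha' : 0 ≤ a') (hb : 0 ≤ b)
    (h : ∀ s ∈ Icc 0 y, a * s - b ≤ g s ∧ g s ≤ a' * s + b) (hs : |s| = y) (m : ℕ) :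
    a / (m + 1).factorial * y ^ (m + 1) - b * y ^ m ≤ |iterPrimitive g m s| ∧
      |iterPrimitive g m s| ≤ a' * y ^ (m + 1) + b * y ^ m := by
  have hy : 0 ≤ y := hs ▸ abs_nonneg s
  have heven : |iterPrimitive g m s| = |iterPrimitive g m y| := by
    rcases abs_choice s with h0 | h0
    · rw [← hs, h0]
    · rw [← hs, h0, iterPrimitive_apply_neg hodd, abs_mul, abs_pow, abs_neg, abs_one, one_pow,
        one_mul]
  have hfac : ∀ n : ℕ, (1 : ℝ) ≤ n.factorial := fun n => by exact_mod_cast Nat.factorial_pos n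
  have hdiv : ∀ n p : ℕ, y ^ p / (n.factorial : ℝ) ≤ y ^ p := fun n p =>
    div_le_self (by positivity) (hfac n)
  have hup := iterPrimitive_le hg (fun t ht => (h t ht).2) m y ⟨hy, le_rfl⟩
  have hlo := iterPrimitive_le (g := fun t => -g t) (a := -a) (b := b) hg.neg
    (fun t ht => by linarith [(h t ht).1]) m y ⟨hy, le_rfl⟩
  rw [iterPrimitive_neg] at hlo
  have h1 := mul_le_mul_of_nonneg_left (hdiv (m + 1) (m + 1)) ha'
  have h2 := mul_le_mul_of_nonneg_left (hdiv m m) hb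
  have h3 : 0 ≤ a * (y ^ (m + 1) / ((m + 1).factorial : ℝ)) := by positivity
  have h4 : 0 ≤ a' * y ^ (m + 1) := by positivity
  rw [heven]
  refine ⟨le_trans ?_ (le_abs_self _), abs_le.2 ⟨by linarith, by linarith⟩⟩
  rw [div_mul_eq_mul_div, ← mul_div_assoc']
  linarith

/-! ### Symmetric differences -/

section SymmetricDifference

variable {k : ℕ} {u x : ℝ} {J : Set ℝ}

lemma symmDifference_add (f g : ℝ → ℝ) :
    symmDifference k u (fun z => f z + g z) x J
      = symmDifference k u f x J + symmDifference k u g x J := by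
  unfold symmDifference
  split_ifs
  · simp only [mul_add, Finset.sum_add_distrib]
  · simp

lemma symmDifference_const_mul (c : ℝ) (f : ℝ → ℝ) :
    symmDifference k u (fun z => c * f z) x J = c * symmDifference k u f x J := by
  unfold symmDifference
  split_ifs
  · rw [Finset.mul_sum]; exact Finset.sum_congr rfl fun i _ => by ring
  · simp

lemma symmDifference_sum {ι : Type*} (s : Finset ι) (f : ι → ℝ → ℝ) :
    symmDifference k u (fun z => ∑ j ∈ s, f j z) x J = ∑ j ∈ s, symmDifference k u (f j) x J := by
  classical
  induction s using Finset.induction_on with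
  | empty => simp [symmDifference]
  | insert a s ha ih => simp only [Finset.sum_insert ha, symmDifference_add, ih]

lemma symmDifference_congr {f g : ℝ → ℝ} {a b : ℝ} (hu : 0 ≤ u) (h : EqOn f g (Icc a b)) :
    symmDifference k u f x (Icc a b) = symmDifference k u g x (Icc a b) := by
  unfold symmDifference
  split_ifs with hJ
  · refine Finset.sum_congr rfl fun i hi => ?_
    have hik : (i : ℝ) ≤ k := by exact_mod_cast Nat.lt_succ_iff.1 (Finset.mem_range.1 hi)
    have h1 : 0 ≤ (i : ℝ) * u := by positivity
    have h2 : (i : ℝ) * u ≤ k * u := mul_le_mul_of_nonneg_right hik hu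
    rw [h]
    have := hJ.1.1
    have := hJ.2.2
    constructor <;> linarith
  · rfl

lemma abs_symmDifference_le {f : ℝ → ℝ} {B : ℝ} (hf : ∀ z, |f z| ≤ B) :
    |symmDifference k u f x J| ≤ 2 ^ k * B := by
  have hB : 0 ≤ B := (abs_nonneg _).trans (hf 0)
  unfold symmDifference
  split_ifs
  · refine (Finset.abs_sum_le_sum_abs _ _).trans ?_
    have h2 : (2 : ℝ) ^ k * B = ∑ i ∈ Finset.range (k + 1), (k.choose i : ℝ) * B := by
      rw [← Finset.sum_mul]
      exact_mod_cast congrArg (fun n : ℕ => (n : ℝ) * B) (Nat.sum_range_choose k).symm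
    rw [h2]
    refine Finset.sum_le_sum fun i _ => ?_
    rw [abs_mul, abs_mul, abs_pow, abs_neg, abs_one, one_pow, one_mul, Nat.abs_cast]
    exact mul_le_mul_of_nonneg_left (hf _) (Nat.cast_nonneg _)
  · simp only [abs_zero]; positivity

/-- The `k`-th difference of a sinusoid, by the binomial theorem for complex exponentials. -/
lemma symmDifference_sin (N x₀ : ℝ) (hJ : x - k * u / 2 ∈ J ∧ x + k * u / 2 ∈ J) :
    symmDifference k u (fun z => Real.sin (N * (z - x₀))) x J
      = (Complex.exp ((N * (x - x₀) : ℝ) * Complex.I) *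
          (Complex.exp ((N * u / 2 : ℝ) * Complex.I)
            - Complex.exp (-((N * u / 2 : ℝ) * Complex.I))) ^ k).im := by
  rw [symmDifference, if_pos hJ, sub_eq_neg_add (Complex.exp _), add_pow, Finset.mul_sum, Complex.im_sum]
  refine Finset.sum_congr rfl fun i hi => ?_
  have hik : i ≤ k := Nat.lt_succ_iff.1 (Finset.mem_range.1 hi)
  rw [← Complex.exp_ofReal_mul_I_im, neg_pow (Complex.exp _), ← Complex.exp_nat_mul, ← Complex.exp_nat_mul]
  have e : Complex.exp ((N * (x + ((k : ℝ) / 2 - i) * u - x₀) : ℝ) * Complex.I)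
      = Complex.exp ((N * (x - x₀) : ℝ) * Complex.I) *
        (Complex.exp (i * -((N * u / 2 : ℝ) * Complex.I)) *
          Complex.exp ((k - i : ℕ) * ((N * u / 2 : ℝ) * Complex.I))) := by
    rw [← Complex.exp_add, ← Complex.exp_add]
    congr 1
    push_cast [Nat.cast_sub hik]
    ring
  rw [e, ← Complex.im_ofReal_mul]
  congr 1
  push_cast
  ring

lemma abs_symmDifference_sin_le (N x₀ : ℝ) :
    |symmDifference k u (fun z => Real.sin (N * (z - x₀))) x J| ≤ |N * u| ^ k := by
  by_cases hJ : x - k * u / 2 ∈ J ∧ x + k * u / 2 ∈ J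
  · rw [symmDifference_sin N x₀ hJ]
    refine (Complex.abs_im_le_norm _).trans ?_
    rw [norm_mul, Complex.norm_exp_ofReal_mul_I, one_mul, norm_pow]
    refine pow_le_pow_left₀ (norm_nonneg _) ?_ k
    have e : Complex.exp ((N * u / 2 : ℝ) * Complex.I)
        - Complex.exp (-((N * u / 2 : ℝ) * Complex.I))
        = Complex.exp ((-(N * u / 2) : ℝ) * Complex.I) *
          (Complex.exp (Complex.I * (N * u : ℝ)) - 1) := by
      rw [mul_sub, ← Complex.exp_add, mul_one]
      congr 2 <;> (push_cast; ring)
    rw [e, norm_mul, Complex.norm_exp_ofReal_mul_I, one_mul]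
    exact Real.norm_exp_I_mul_ofReal_sub_one_le
  · rw [symmDifference, if_neg hJ, abs_zero]
    positivity

end SymmetricDifference

/-- As a function of the centre, the difference of `sin` is a sinusoid of nonzero amplitude, so it
cannot vanish at both `0` and `1 / 2`. -/
lemma exists_symmDifference_sin_ne_zero {k : ℕ} {u : ℝ} (x₀ : ℝ) (hu : 0 < u) (hu1 : u ≤ 1)
    (hku : k * u ≤ 1) :
    ∃ x ∈ Icc (-1 : ℝ) 1,
      symmDifference k u (fun z => Real.sin (z - x₀)) x (Icc (-1) 1) ≠ 0 := by
  by_contra! H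
  set W : ℂ := (Complex.exp ((1 * u / 2 : ℝ) * Complex.I)
            - Complex.exp (-((1 * u / 2 : ℝ) * Complex.I))) ^ k with hW
  have hku0 : 0 ≤ k * u := by positivity
  have key : ∀ x ∈ Icc (0 : ℝ) (1 / 2),
      (Complex.exp ((1 * (x - x₀) : ℝ) * Complex.I) * W).im = 0 := by
    intro x hx
    have hx0 := hx.1
    have hx1 := hx.2
    rw [hW, ← symmDifference_sin (J := Icc (-1) 1) 1 x₀
      ⟨⟨by linarith, by linarith⟩, ⟨by linarith, by linarith⟩⟩]
    simpa using H x ⟨by linarith, by linarith⟩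
  have hW0 : W ≠ 0 := by
    refine pow_ne_zero _ fun h => ?_
    have h' := congrArg Complex.im h
    rw [← neg_mul, ← Complex.ofReal_neg, Complex.sub_im, Complex.exp_ofReal_mul_I_im,
      Complex.exp_ofReal_mul_I_im, Real.sin_neg, Complex.zero_im] at h'
    have := Real.sin_pos_of_pos_of_lt_pi (x := 1 * u / 2) (by linarith)
      (by linarith [Real.pi_gt_three])
    linarith
  set V : ℂ := Complex.exp ((1 * (0 - x₀) : ℝ) * Complex.I) * W with hV
  have h0 : V.im = 0 := key 0 (by norm_num)
  have h1 : (Complex.exp ((1 / 2 : ℝ) * Complex.I) * V).im = 0 := by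
    rw [← key (1 / 2) (by norm_num), hV, ← mul_assoc, ← Complex.exp_add]
    congr 3
    push_cast
    ring
  rw [Complex.mul_im, h0, Complex.exp_ofReal_mul_I_im, mul_zero, zero_add] at h1
  have hs := Real.sin_pos_of_pos_of_lt_pi (x := 1 / 2) (by norm_num)
      (by linarith [Real.pi_gt_three])
  have hre : V.re = 0 := by
    rcases mul_eq_zero.1 h1 with h | h
    · exact absurd h hs.ne'
    · exact h
  exact mul_ne_zero (Complex.exp_ne_zero _) hW0 (Complex.ext hre h0)

/-! ### The modulus of smoothness -/

section Modulus

variable {k : ℕ} {f : ℝ → ℝ} {t B : ℝ} {J : Set ℝ}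

lemma smoothnessModulus_le (hB : 0 ≤ B)
    (h : ∀ u ∈ Ioc 0 t, ∀ x ∈ J, |symmDifference k u f x J| ≤ B) :
    smoothnessModulus k f t J ≤ B := by
  refine Real.sSup_le ?_ hB
  rintro y ⟨u, hu, x, hx, rfl⟩
  exact h u hu x hx

lemma smoothnessModulus_pos (h : ∀ z, |f z| ≤ B)
    (hne : ∃ u ∈ Ioc 0 t, ∃ x ∈ J, symmDifference k u f x J ≠ 0) :
    0 < smoothnessModulus k f t J := by
  obtain ⟨u, hu, x, hx, hd⟩ := hne
  refine (abs_pos.2 hd).trans_le (le_csSup ⟨2 ^ k * B, ?_⟩ ⟨u, hu, x, hx, rfl⟩)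
  rintro y ⟨v, -, z, -, rfl⟩
  exact abs_symmDifference_le h

lemma smoothnessModulus_congr {f g : ℝ → ℝ} {a b : ℝ} (h : EqOn f g (Icc a b)) :
    smoothnessModulus k f t (Icc a b) = smoothnessModulus k g t (Icc a b) := by
  unfold smoothnessModulus
  congr 1
  ext y
  refine exists_congr fun u => and_congr_right fun hu => ?_
  simp only [symmDifference_congr hu.1.le h]

end Modulus

/-! ### Lacunary sine series -/

/-- The part `∑_{j ≥ n} sin (N_j s) / N_j` of the lacunary sine series with frequencies `N_j`. -/
noncomputable def lacunaryTail (N : ℕ → ℝ) (n : ℕ) (s : ℝ) : ℝ :=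
  ∑' j, Real.sin (N (n + j) * s) / N (n + j)

/-- The full lacunary sine series, to which a multiple `c` of `sin` is added. -/
noncomputable def lacunarySine (c : ℝ) (N : ℕ → ℝ) (s : ℝ) : ℝ :=
  c * Real.sin s + lacunaryTail N 0 s

section Lacunary

variable {N : ℕ → ℝ} (hN : ∀ n, 1 ≤ N n) (hN2 : ∀ n, 2 * N n ≤ N (n + 1))
include hN hN2

omit hN in
lemma two_pow_mul_le_of_two_mul_le (n j : ℕ) : 2 ^ j * N n ≤ N (n + j) := by
  induction j with
  | zero => simp
  | succ j ih =>
    have := hN2 (n + j)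
    rw [pow_succ, ← add_assoc]
    linarith

lemma abs_lacunary_term_le (n j : ℕ) (s : ℝ) :
    |Real.sin (N (n + j) * s) / N (n + j)| ≤ 1 / N n * (1 / 2) ^ j := by
  have h1 := hN n
  have h2 := two_pow_mul_le_of_two_mul_le hN2 n j
  have h3 := hN (n + j)
  rw [abs_div, abs_of_pos (by linarith : 0 < N (n + j))]
  calc _ ≤ 1 / N (n + j) := by gcongr; exact Real.abs_sin_le_one _
    _ ≤ 1 / (2 ^ j * N n) := by gcongr
    _ = _ := by rw [one_div_pow]; field_simp

lemma summable_lacunary_term (n : ℕ) (s : ℝ) :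
    Summable fun j => Real.sin (N (n + j) * s) / N (n + j) :=
  Summable.of_norm_bounded (summable_geometric_two.mul_left (1 / N n))
    (fun j => abs_lacunary_term_le hN hN2 n j s)

lemma abs_lacunaryTail_le (n : ℕ) (s : ℝ) : |lacunaryTail N n s| ≤ 2 / N n := by
  have h := tsum_of_norm_bounded (f := fun j => Real.sin (N (n + j) * s) / N (n + j))
    (hasSum_geometric_two.mul_left (1 / N n)) (fun j => abs_lacunary_term_le hN hN2 n j s)
  exact h.trans_eq (by ring)

lemma continuous_lacunarySine (c : ℝ) : Continuous (lacunarySine c N) := by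
  have h : Continuous (lacunaryTail N 0) :=
    continuous_tsum (fun j => by fun_prop) (summable_geometric_two.mul_left (1 / N 0))
      (fun j s => abs_lacunary_term_le hN hN2 0 j s)
  unfold lacunarySine
  fun_prop

lemma lacunarySine_eq (c : ℝ) (n : ℕ) (s : ℝ) :
    lacunarySine c N s = c * Real.sin s + ∑ j ∈ Finset.range n, Real.sin (N j * s) / N j
      + lacunaryTail N n s := by
  have h := (summable_lacunary_term hN hN2 0 s).sum_add_tsum_nat_add n
  simp only [zero_add] at h
  unfold lacunarySine lacunaryTail
  simp only [zero_add, ← h, add_comm n]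
  ring

omit hN hN2 in
lemma lacunarySine_neg (c s : ℝ) : lacunarySine c N (-s) = -lacunarySine c N s := by
  simp only [lacunarySine, lacunaryTail, mul_neg, Real.sin_neg, neg_div, tsum_neg]
  ring

lemma abs_lacunarySine_le {c : ℝ} (hc : |c| ≤ 1) (s : ℝ) : |lacunarySine c N s| ≤ 3 := by
  have h1 : |c * Real.sin s| ≤ 1 := by
    rw [abs_mul]
    exact mul_le_one₀ hc (abs_nonneg _) (Real.abs_sin_le_one _)
  have h2 : 2 / N 0 ≤ 2 := div_le_self (by norm_num) (hN 0)
  have h3 := abs_lacunaryTail_le hN hN2 0 s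
  have h4 := abs_add_le (c * Real.sin s) (lacunaryTail N 0 s)
  unfold lacunarySine
  linarith

lemma monotone_of_two_mul_le : Monotone N :=
  monotone_nat_of_le_succ fun n => by linarith [hN n, hN2 n]

/-- Below the scale `1 / N_n`, the first `n + 1` terms are comparable to `s`. -/
lemma lacunarySine_bounds {c : ℝ} (hc : c ∈ Icc (0 : ℝ) 1) {n : ℕ} {s : ℝ} (hs : 0 ≤ s)
    (hsN : s * N n ≤ 1) :
    (n + 1) / 2 * s - 2 / N (n + 1) ≤ lacunarySine c N s ∧
      lacunarySine c N s ≤ (n + 2) * s + 2 / N (n + 1) := by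
  have hs1 : s ≤ 1 := by nlinarith [hN n]
  have hterm : ∀ j ∈ Finset.range (n + 1),
      1 / 2 * s ≤ Real.sin (N j * s) / N j ∧ Real.sin (N j * s) / N j ≤ s := by
    intro j hj
    have hj' : N j ≤ N n :=
      monotone_of_two_mul_le hN hN2 (Nat.lt_succ_iff.1 (Finset.mem_range.1 hj))
    have hj1 := hN j
    have h0 : 0 ≤ N j * s := by positivity
    have h1 : N j * s ≤ 1 := by nlinarith
    rw [le_div_iff₀ (by linarith), div_le_iff₀ (by linarith)]
    constructor
    · have h2 := Real.mul_le_sin h0 (by linarith [Real.pi_gt_three])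
      have h3 : 1 / 2 ≤ 2 / Real.pi := by
        rw [div_le_div_iff₀ (by norm_num) Real.pi_pos]; linarith [Real.pi_le_four]
      nlinarith
    · linarith [Real.sin_le h0]
  have hlo := Finset.card_nsmul_le_sum _ _ _ fun j hj => (hterm j hj).1
  have hup := Finset.sum_le_card_nsmul _ _ _ fun j hj => (hterm j hj).2
  rw [Finset.card_range, nsmul_eq_mul] at hlo hup
  push_cast at hlo hup
  have ht := abs_le.1 (abs_lacunaryTail_le hN hN2 (n + 1) s)
  have hsin0 : 0 ≤ Real.sin s :=
    Real.sin_nonneg_of_nonneg_of_le_pi hs (by linarith [Real.pi_gt_three])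
  have hsin1 := Real.sin_le hs
  have hc0 : 0 ≤ c * Real.sin s := mul_nonneg hc.1 hsin0
  have hc1 : c * Real.sin s ≤ s := by nlinarith [hc.2]
  rw [lacunarySine_eq hN hN2 c (n + 1)]
  constructor <;> linarith [ht.1, ht.2]

/-- The first `n + 1` terms contribute at most their `k`th derivative times `u ^ k`, the remaining
ones are small in absolute value. -/
lemma abs_symmDifference_lacunarySine_le {c : ℝ} (hc : |c| ≤ 1) {k : ℕ} {u : ℝ}
    (hu : 0 ≤ u) (x₀ x : ℝ) (J : Set ℝ) (n : ℕ) :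
    |symmDifference k u (fun z => lacunarySine c N (z - x₀)) x J|
      ≤ (n + 2) * (N n * u) ^ k + 2 ^ k * (2 / N (n + 1)) := by
  have hterm : ∀ j ∈ Finset.range (n + 1),
      |symmDifference k u (fun z => Real.sin (N j * (z - x₀)) / N j) x J| ≤ (N n * u) ^ k := by
    intro j hj
    have hj' : N j ≤ N n :=
      monotone_of_two_mul_le hN hN2 (Nat.lt_succ_iff.1 (Finset.mem_range.1 hj))
    have hj1 := hN j
    simp only [div_eq_inv_mul, symmDifference_const_mul, abs_mul]
    have h1 := abs_symmDifference_sin_le (k := k) (u := u) (x := x) (J := J) (N j) x₀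
    rw [abs_of_nonneg (by positivity : 0 ≤ N j * u)] at h1
    have h2 : |(N j)⁻¹| ≤ 1 := by
      rw [abs_of_nonneg (by positivity)]; exact inv_le_one_of_one_le₀ hj1
    calc _ ≤ 1 * (N j * u) ^ k := by gcongr
      _ ≤ _ := by rw [one_mul]; gcongr
  have hsum := (Finset.abs_sum_le_sum_abs _ _).trans (Finset.sum_le_card_nsmul _ _ _ hterm)
  rw [Finset.card_range, nsmul_eq_mul] at hsum
  push_cast at hsum
  have hsin : |symmDifference k u (fun z => c * Real.sin (z - x₀)) x J| ≤ (N n * u) ^ k := by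
    rw [symmDifference_const_mul, abs_mul]
    have h1 := abs_symmDifference_sin_le (k := k) (u := u) (x := x) (J := J) 1 x₀
    simp only [one_mul] at h1
    rw [abs_of_nonneg hu] at h1
    calc _ ≤ 1 * u ^ k := by gcongr
      _ ≤ _ := by
        rw [one_mul]
        exact pow_le_pow_left₀ hu (le_mul_of_one_le_left hu (hN n)) k
  have htail := abs_symmDifference_le (k := k) (u := u) (x := x) (J := J)
    (f := fun z => lacunaryTail N (n + 1) (z - x₀))
    (fun z => abs_lacunaryTail_le hN hN2 (n + 1) (z - x₀))
  simp only [lacunarySine_eq hN hN2 c (n + 1), symmDifference_add, symmDifference_sum]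
  refine (abs_add_le _ _).trans ?_
  linarith [abs_add_le (symmDifference k u (fun z => c * Real.sin (z - x₀)) x J)
    (∑ j ∈ Finset.range (n + 1), symmDifference k u (fun z => Real.sin (N j * (z - x₀)) / N j) x J)]

/-- If the modulus of the bare series vanishes at some `t₀`, then for steps `u ≤ t₀` the differences
of the series with `sin` added are those of `sin`, which are not all zero. -/
lemma exists_smoothnessModulus_lacunarySine_pos (k : ℕ) (x₀ : ℝ) :
    ∃ c ∈ Icc (0 : ℝ) 1, ∀ t, 0 < t →
      0 < smoothnessModulus k (fun z => lacunarySine c N (z - x₀)) t (Icc (-1) 1) := by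
  suffices h : ∃ c ∈ Icc (0 : ℝ) 1, ∀ t, 0 < t → ∃ u ∈ Ioc 0 t, ∃ x ∈ Icc (-1 : ℝ) 1,
      symmDifference k u (fun z => lacunarySine c N (z - x₀)) x (Icc (-1) 1) ≠ 0 by
    obtain ⟨c, hc, h⟩ := h
    refine ⟨c, hc, fun t ht => smoothnessModulus_pos (B := 3) (fun z => ?_) (h t ht)⟩
    exact abs_lacunarySine_le hN hN2 (abs_le.2 ⟨by linarith [hc.1], hc.2⟩) _
  by_cases h : ∀ t, 0 < t → ∃ u ∈ Ioc 0 t, ∃ x ∈ Icc (-1 : ℝ) 1,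
      symmDifference k u (fun z => lacunarySine 0 N (z - x₀)) x (Icc (-1) 1) ≠ 0
  · exact ⟨0, by norm_num, h⟩
  push Not at h
  obtain ⟨t₀, ht₀, h⟩ := h
  refine ⟨1, by norm_num, fun t ht => ?_⟩
  have hk0 : (0 : ℝ) ≤ k := Nat.cast_nonneg k
  set u := min t (min t₀ (1 / (k + 1))) with hu
  have hu0 : 0 < u := lt_min ht (lt_min ht₀ (by positivity))
  have hu3 : u * (k + 1) ≤ 1 := by
    rw [← le_div_iff₀ (by positivity)]
    exact (min_le_right _ _).trans (min_le_right _ _)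
  obtain ⟨x, hx, hne⟩ := exists_symmDifference_sin_ne_zero (k := k) x₀ hu0
    (by nlinarith) (by nlinarith)
  refine ⟨u, ⟨hu0, min_le_left _ _⟩, x, hx, ?_⟩
  have e : (fun z => lacunarySine 1 N (z - x₀))
      = fun z => Real.sin (z - x₀) + lacunarySine 0 N (z - x₀) := by
    funext z; simp [lacunarySine]
  rwa [e, symmDifference_add, h u ⟨hu0, (min_le_right _ _).trans (min_le_left _ _)⟩ x hx, add_zero]

end Lacunary

/-! ### Choice of the frequencies and test scales -/

/-- Frequencies `N` and test scales `y`, chosen alternately: `y_n` is small in terms of `N_n`, and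
`N_{n+1}` is large in terms of `y_n`. The factor `2 ^ (k + 1)` makes the `k`th differences of the
terms from `N_{n+1}` on at most `y_n ^ (r + 1)`, and at least doubles the frequency. -/
lemma exists_frequencies_and_scales (k : ℕ) (hk : 1 ≤ k) (r : ℕ) {ε : ℝ → ℝ}
    (hε_lim : Tendsto ε (𝓝[>] (0 : ℝ)) (𝓝 0)) :
    ∃ N y : ℕ → ℝ, (∀ n, 1 ≤ N n) ∧ ∀ n, y n ∈ Ioc (0 : ℝ) 1 ∧ y n * N n ≤ 1 ∧
      ((n : ℝ) + 1) ^ 2 * y n ≤ 1 ∧ ((n : ℝ) + 2) * (N n * ε (y n)) ^ k ≤ 1 ∧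
      N (n + 1) * y n ^ (r + 1) = 2 ^ (k + 1) := by
  have key : ∀ (n : ℕ) (M : ℝ), ∃ y : ℝ, y ∈ Ioc (0 : ℝ) 1 ∧ y * M ≤ 1 ∧
      ((n : ℝ) + 1) ^ 2 * y ≤ 1 ∧ ((n : ℝ) + 2) * (M * ε y) ^ k ≤ 1 := by
    intro n M
    have hid : Tendsto (fun y : ℝ => y) (𝓝[>] 0) (𝓝 0) := tendsto_id.mono_left nhdsWithin_le_nhds
    have h1 : Tendsto (fun y : ℝ => y * M) (𝓝[>] 0) (𝓝 0) := by simpa using hid.mul_const M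
    have h2 : Tendsto (fun y : ℝ => ((n : ℝ) + 1) ^ 2 * y) (𝓝[>] 0) (𝓝 0) := by
      simpa using hid.const_mul (((n : ℝ) + 1) ^ 2)
    have h3 : Tendsto (fun y : ℝ => ((n : ℝ) + 2) * (M * ε y) ^ k) (𝓝[>] 0) (𝓝 0) := by
      simpa [show k ≠ 0 by omega] using ((hε_lim.const_mul M).pow k).const_mul ((n : ℝ) + 2)
    have hone : Iic (1 : ℝ) ∈ 𝓝 0 := Iic_mem_nhds one_pos
    obtain ⟨y, hy, h, h'⟩ := ((eventually_mem_nhdsWithin (a := (0 : ℝ)) (s := Ioi 0)).and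
      ((hid.eventually_mem hone).and ((h1.eventually_mem hone).and
      ((h2.eventually_mem hone).and (h3.eventually_mem hone))))).exists
    exact ⟨y, ⟨hy, h⟩, h'.1, h'.2.1, h'.2.2⟩
  choose Y hY using key
  let N : ℕ → ℝ := fun n => Nat.rec 1 (fun n M => 2 ^ (k + 1) / Y n M ^ (r + 1)) n
  have hNs : ∀ n, N (n + 1) = 2 ^ (k + 1) / Y n (N n) ^ (r + 1) := fun n => rfl
  refine ⟨N, fun n => Y n (N n), fun n => ?_, fun n => ?_⟩
  · cases n with
    | zero => exact le_rfl
    | succ n =>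
      have h := (hY n (N n)).1
      rw [hNs, one_le_div (pow_pos h.1 _)]
      exact (pow_le_one₀ h.1.le h.2).trans (one_le_pow₀ (by norm_num))
  · obtain ⟨h1, h2, h3, h4⟩ := hY n (N n)
    refine ⟨h1, h2, h3, h4, ?_⟩
    rw [hNs, div_mul_cancel₀ _ (pow_pos h1.1 _).ne']

/-! ### Comparison with polynomials -/

/-- A polynomial either vanishes to order `r + 1` at `x₀`, or it is at least of order
`|x - x₀| ^ r` there. -/
lemma Polynomial.eventually_abs_eval_le_or_ge (P : Polynomial ℝ) (x₀ : ℝ) (r : ℕ) :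
    (∃ C, ∀ᶠ x in 𝓝 x₀, |P.eval x| ≤ C * |x - x₀| ^ (r + 1)) ∨
      ∃ c, 0 < c ∧ ∀ᶠ x in 𝓝 x₀, c * |x - x₀| ^ r ≤ |P.eval x| := by
  rcases eq_or_ne P 0 with rfl | hP
  · exact Or.inl ⟨0, by simp⟩
  obtain ⟨R, hR, hndvd⟩ := P.exists_eq_pow_rootMultiplicity_mul_and_not_dvd hP x₀
  set m := P.rootMultiplicity x₀
  have hR0 : 0 < |R.eval x₀| := abs_pos.2 fun h => hndvd (Polynomial.dvd_iff_isRoot.2 h)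
  have hcont : Tendsto (fun x => |R.eval x|) (𝓝 x₀) (𝓝 |R.eval x₀|) :=
    R.continuous.abs.tendsto x₀
  have heval : ∀ x, |P.eval x| = |x - x₀| ^ m * |R.eval x| := fun x => by
    rw [hR]; simp [abs_mul]
  have hnear : ∀ᶠ x in 𝓝 x₀, |x - x₀| ≤ 1 := by
    have : Tendsto (fun x => |x - x₀|) (𝓝 x₀) (𝓝 0) := by
      simpa using ((continuous_id.sub continuous_const).abs.tendsto x₀ :
        Tendsto (fun x => |x - x₀|) (𝓝 x₀) (𝓝 |x₀ - x₀|))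
    exact this (Iic_mem_nhds one_pos)
  rcases le_or_gt (r + 1) m with hm | hm
  · refine Or.inl ⟨|R.eval x₀| + 1, ?_⟩
    filter_upwards [hnear, hcont (Iic_mem_nhds (lt_add_one _))] with x h1 h2
    rw [heval, mul_comm]
    exact mul_le_mul h2 (pow_le_pow_of_le_one (abs_nonneg _) h1 hm) (by positivity) (by positivity)
  · refine Or.inr ⟨|R.eval x₀| / 2, by positivity, ?_⟩
    filter_upwards [hnear, hcont (Ici_mem_nhds (half_lt_self hR0))] with x h1 h2
    rw [heval, mul_comm]
    exact mul_le_mul (pow_le_pow_of_le_one (abs_nonneg _) h1 (by omega)) h2 (by positivity)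
      (by positivity)

/-- If `|F|` is comparable to `n |x - x₀| ^ (r + 1)` along a sequence of points `x_n` tending
to `x₀` fast enough, then no polynomial approximates `F` to order `r + 1` along it. The rate
`y_n ≤ (n + 1) ^ (-2)` makes `F` negligible against `|x - x₀| ^ r`. -/
lemma eventually_mul_pow_le_abs_sub_eval {r : ℕ} {x₀ : ℝ} {F : ℝ → ℝ} {x y : ℕ → ℝ} {a b : ℝ}
    (ha : 0 < a) (hx : Tendsto x atTop (𝓝 x₀)) (hxy : ∀ n, |x n - x₀| = y n)
    (hy : ∀ n : ℕ, ((n : ℝ) + 1) ^ 2 * y n ≤ 1)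
    (hF : ∀ n : ℕ, (a * (n + 1) - 1) * y n ^ (r + 1) ≤ |F (x n)| ∧
      |F (x n)| ≤ (n + b) * y n ^ (r + 1)) (P : Polynomial ℝ) (M : ℝ) :
    ∀ᶠ n in atTop, M * y n ^ (r + 1) ≤ |F (x n) - P.eval (x n)| := by
  have hy0 : ∀ n, 0 ≤ y n := fun n => hxy n ▸ abs_nonneg _
  have hnat : Tendsto (fun n : ℕ => (n : ℝ)) atTop atTop := tendsto_natCast_atTop_atTop
  rcases Polynomial.eventually_abs_eval_le_or_ge P x₀ r with ⟨C, hC⟩ | ⟨c, hc, hC⟩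
  · filter_upwards [hx.eventually hC, hnat.eventually_ge_atTop ((M + 1 + C) / a)] with n h1 h2
    rw [hxy] at h1
    rw [div_le_iff₀ ha] at h2
    have h3 := abs_sub_abs_le_abs_sub (F (x n)) (P.eval (x n))
    have h4 : (M + C) * y n ^ (r + 1) ≤ (a * (n + 1) - 1) * y n ^ (r + 1) :=
      mul_le_mul_of_nonneg_right (by nlinarith) (pow_nonneg (hy0 n) _)
    linarith [(hF n).1]
  · filter_upwards [hx.eventually hC, hnat.eventually_ge_atTop (2 / c),
      hnat.eventually_ge_atTop (M + b)] with n h1 h2 h3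
    rw [hxy] at h1
    rw [div_le_iff₀ hc] at h2
    have h4 := abs_sub_abs_le_abs_sub (P.eval (x n)) (F (x n))
    rw [abs_sub_comm] at h4
    have h5 : ((n : ℝ) + 1) ^ 2 * y n ^ (r + 1) ≤ y n ^ r := by
      rw [pow_succ' (y n), ← mul_assoc]
      exact mul_le_of_le_one_left (pow_nonneg (hy0 n) r) (hy n)
    have h6 : M + (n + b) ≤ c * ((n : ℝ) + 1) ^ 2 := by
      nlinarith [Nat.cast_nonneg (α := ℝ) n]
    have h7 := mul_le_mul_of_nonneg_right h6 (pow_nonneg (hy0 n) (r + 1))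
    have h8 := mul_le_mul_of_nonneg_left h5 hc.le
    linarith [(hF n).2]

/-! ### The limit superior -/

theorem mainTheorem9 (k : ℕ) (hk : 1 ≤ k) (r : ℕ) (x₀ : ℝ) (hx₀ : x₀ ∈ Icc (-1 : ℝ) 1)
    (ε : ℝ → ℝ) (hε_cont : ContinuousOn ε (Ioc (0 : ℝ) 1))
    (hε_pos : ∀ x ∈ Ioc (0 : ℝ) 1, 0 < ε x)
    (hε_lim : Tendsto ε (𝓝[>] (0 : ℝ)) (𝓝 0)) :
    ∃ F : ℝ → ℝ, ContDiffOn ℝ (r : WithTop ℕ∞) F (Icc (-1 : ℝ) 1) ∧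
      ∀ P : Polynomial ℝ, ∀ α β : ℝ, 0 ≤ α → α + (k : ℝ) * β = (r : ℝ) + 1 →
        limsup
          (fun x : ℝ =>
            ((|F x - P.eval x| /
              (|x - x₀| ^ α *
                smoothnessModulus k (iteratedDerivWithin r F (Icc (-1 : ℝ) 1))
                  (ε |x - x₀| * |x - x₀| ^ β) (Icc (-1 : ℝ) 1)) : ℝ) : EReal))
          (𝓝[Icc (-1 : ℝ) 1 \ {x₀}] x₀) = ⊤ := by
  obtain ⟨N, y, hN, hNy⟩ := exists_frequencies_and_scales k hk r hε_lim
  have hy : ∀ n, y n ∈ Ioc (0 : ℝ) 1 := fun n => (hNy n).1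
  have hpow : ∀ n, 0 < y n ^ (r + 1) := fun n => pow_pos (hy n).1 _
  have hpow_le : ∀ n, y n ^ (r + 1) ≤ y n := fun n =>
    pow_le_of_le_one (hy n).1.le (hy n).2 r.succ_ne_zero
  have htail : ∀ n, 2 ^ k * (2 / N (n + 1)) = y n ^ (r + 1) := by
    intro n
    have h := (hNy n).2.2.2.2
    have := hN (n + 1)
    rw [mul_div_assoc', ← pow_succ, ← h]
    field_simp
  have hpk : (2 : ℝ) ≤ 2 ^ k := le_self_pow₀ (by norm_num) (by omega)
  have htail' : ∀ n, 2 / N (n + 1) ≤ y n := fun n => by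
    have := hN (n + 1)
    have : 0 ≤ 2 / N (n + 1) := by positivity
    nlinarith [htail n, hpow_le n]
  have hN2 : ∀ n, 2 * N n ≤ N (n + 1) := by
    intro n
    have h1 := (hNy n).2.1
    have h2 := htail n
    have h3 := hN (n + 1)
    have h4 : 0 < 2 / N (n + 1) := by positivity
    have h5 : 2 / N (n + 1) * N n ≤ 1 := by nlinarith [htail' n, hN n]
    rw [div_mul_eq_mul_div, div_le_one (by linarith)] at h5
    exact h5
  obtain ⟨c, hc, hpos⟩ := exists_smoothnessModulus_lacunarySine_pos hN hN2 k x₀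
  have hc' : |c| ≤ 1 := abs_le.2 ⟨by linarith [hc.1], hc.2⟩
  set g := lacunarySine c N with hg_def
  have hg : Continuous g := continuous_lacunarySine hN hN2 c
  have hF : ContDiff ℝ r fun x => iterPrimitive g r (x - x₀) :=
    (contDiff_iterPrimitive hg r).comp (contDiff_id.sub contDiff_const)
  have hderiv : EqOn (iteratedDerivWithin r (fun x => iterPrimitive g r (x - x₀)) (Icc (-1) 1))
      (fun x => g (x - x₀)) (Icc (-1) 1) := by
    intro x hx
    rw [iteratedDerivWithin_eq_iteratedDeriv (uniqueDiffOn_Icc (by norm_num)) hF.contDiffAt hx,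
      iteratedDeriv_comp_sub_const, iteratedDeriv_iterPrimitive hg]
  refine ⟨fun x => iterPrimitive g r (x - x₀), hF.contDiffOn, fun P α β hα hαβ => ?_⟩
  -- The test points lie on the side of `x₀` on which the interval has length at least `1`.
  obtain ⟨σ, hσ, hσI⟩ : ∃ σ : ℝ, |σ| = 1 ∧ ∀ s ∈ Ioc (0 : ℝ) 1, x₀ + σ * s ∈ Icc (-1 : ℝ) 1 := by
    rcases le_total 0 x₀ with h | h
    · exact ⟨-1, by simp, fun s hs => ⟨by linarith [hs.2], by linarith [hs.1, hx₀.2]⟩⟩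
    · exact ⟨1, by simp, fun s hs => ⟨by linarith [hs.1, hx₀.1], by linarith [hs.2]⟩⟩
  set x : ℕ → ℝ := fun n => x₀ + σ * y n with hx_def
  have hxy : ∀ n, |x n - x₀| = y n := fun n => by
    simp [hx_def, abs_mul, hσ, abs_of_pos (hy n).1]
  have hy_lim : Tendsto y atTop (𝓝 0) := by
    refine squeeze_zero (fun n => (hy n).1.le) (fun n => ?_) tendsto_one_div_add_atTop_nhds_zero_nat
    rw [le_div_iff₀ (by positivity)]
    have := (hNy n).2.2.1
    have := (hy n).1
    have : (0 : ℝ) ≤ n := Nat.cast_nonneg n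
    nlinarith
  have hx_lim : Tendsto x atTop (𝓝 x₀) := by
    simpa using (hy_lim.const_mul σ).const_add x₀
  have hx_lim' : Tendsto x atTop (𝓝[Icc (-1 : ℝ) 1 \ {x₀}] x₀) := by
    refine tendsto_nhdsWithin_iff.2 ⟨hx_lim, .of_forall fun n => ⟨hσI _ (hy n), fun h => ?_⟩⟩
    have := hxy n
    rw [mem_singleton_iff.1 h, sub_self, abs_zero] at this
    exact (hy n).1.ne this
  have hFx : ∀ n : ℕ, (1 / 2 / ((r + 1).factorial : ℝ) * (n + 1) - 1) * y n ^ (r + 1)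
      ≤ |iterPrimitive g r (x n - x₀)| ∧
      |iterPrimitive g r (x n - x₀)| ≤ (n + 3) * y n ^ (r + 1) := by
    intro n
    have h := abs_iterPrimitive_bounds hg (lacunarySine_neg (N := N) c) (a := (n + 1) / 2)
      (a' := n + 2) (b := y n) (by positivity) (by positivity) (hy n).1.le (fun s hs => ?_)
      (hxy n) r
    · refine ⟨le_trans (le_of_eq ?_) h.1, h.2.trans (le_of_eq ?_)⟩
      · rw [pow_succ]; ring
      · rw [pow_succ]; ring
    · have hsN : s * N n ≤ 1 :=
        (mul_le_mul_of_nonneg_right hs.2 (by linarith [hN n])).trans (hNy n).2.1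
      have := lacunarySine_bounds hN hN2 hc hs.1 hsN
      constructor <;> linarith [htail' n]
  have hden : ∀ n, 0 < y n ^ α * smoothnessModulus k
      (iteratedDerivWithin r (fun x => iterPrimitive g r (x - x₀)) (Icc (-1) 1))
        (ε (y n) * y n ^ β) (Icc (-1) 1) ∧ y n ^ α * smoothnessModulus k
      (iteratedDerivWithin r (fun x => iterPrimitive g r (x - x₀)) (Icc (-1) 1))
        (ε (y n) * y n ^ β) (Icc (-1) 1) ≤ 2 * y n ^ (r + 1) := by
    intro n
    have hyn := (hy n).1
    have hεn := hε_pos _ (hy n)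
    have hNn := hN n
    rw [smoothnessModulus_congr hderiv]
    refine ⟨mul_pos (Real.rpow_pos_of_pos hyn α)
      (hpos _ (mul_pos hεn (Real.rpow_pos_of_pos hyn β))), ?_⟩
    have hω : smoothnessModulus k (fun z => g (z - x₀)) (ε (y n) * y n ^ β) (Icc (-1) 1)
        ≤ (n + 2) * (N n * (ε (y n) * y n ^ β)) ^ k + y n ^ (r + 1) := by
      refine smoothnessModulus_le (by positivity) fun u hu z _ => ?_
      have hu0 := hu.1.le
      refine (abs_symmDifference_lacunarySine_le hN hN2 hc' hu0 x₀ z _ n).trans ?_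
      rw [htail]
      gcongr
      exact hu.2
    -- The relation between `α` and `β` turns the smooth part into a multiple of `y ^ (r + 1)`.
    have hexp : y n ^ α * (y n ^ β) ^ k = y n ^ (r + 1) := by
      rw [← Real.rpow_mul_natCast hyn.le, ← Real.rpow_add hyn, mul_comm β, hαβ,
        ← Real.rpow_natCast]
      push_cast
      rfl
    calc _ ≤ y n ^ α * ((n + 2) * (N n * (ε (y n) * y n ^ β)) ^ k + y n ^ (r + 1)) := by gcongr
      _ = (n + 2) * (N n * ε (y n)) ^ k * (y n ^ α * (y n ^ β) ^ k)
          + y n ^ α * y n ^ (r + 1) := by ring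
      _ ≤ 1 * y n ^ (r + 1) + 1 * y n ^ (r + 1) := by
        rw [hexp]
        gcongr
        · exact (hNy n).2.2.2.1
        · exact Real.rpow_le_one hyn.le (hy n).2 hα
      _ = _ := by ring
  refine EReal.eq_top_iff_forall_lt _ |>.2 fun M => ?_
  refine lt_of_lt_of_le (EReal.coe_lt_coe_iff.2 (lt_add_one M)) ?_
  refine le_limsup_of_frequently_le (hx_lim'.frequently (Eventually.frequently ?_))
  filter_upwards [eventually_mul_pow_le_abs_sub_eval (F := fun x => iterPrimitive g r (x - x₀))
    (a := 1 / 2 / ((r + 1).factorial : ℝ)) (b := 3) (by positivity) hx_lim hxy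
    (fun n : ℕ => (hNy n).2.2.1) hFx P (2 * |M + 1|)] with n hn
  rw [EReal.coe_le_coe_iff, hxy, le_div_iff₀ (hden n).1]
  calc _ ≤ |M + 1| * (2 * y n ^ (r + 1)) :=
        mul_le_mul (le_abs_self _) (hden n).2 (hden n).1.le (abs_nonneg _)
    _ ≤ _ := by linarith
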